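/- A \emph{game} consists of a finite set of states $S = S_1 \uplus S_2$ (the states of player 1 and of player 2; either part may be empty), a set of edges $T \subseteq S \times S$ such that every state has at least one outgoing edge, and a weight function $w : T \to \mathbb{Z}$. A \emph{play} is an infinite path $\pi = s_0 s_1 s_2 \cdots$ along edges. Its energy level at position $n$ is $EL_n(\pi) = \sum_{i=0}^{n-1} w(s_i,s_{i+1})$, and its average-energy payoff, in the limsup and in the liminf variant, is $$\overline{AE}(\pi) = \limsup_{n\to\infty} \frac1n \sum_{i=1}^{n} EL_i(\pi), \qquad \underline{AE}(\pi) = \liminf_{n\to\infty} \frac1n \sum_{i=1}^{n} EL_i(\pi) \qquad \text{in } [-\infty,+\infty].$$ A strategy of player $i$ maps every finite path $s_0 \cdots s_n$ with $s_n \in S_i$ to a successor of $s_n$; it is \emph{memoryless} if its choice depends only on $s_n$. An initial state $s$ and strategies $\sigma_1, \sigma_2$ of the two players determine a unique play $\mathrm{Out}(s,\sigma_1,\sigma_2)$; $\mathrm{Outs}(s,\sigma_1)$ is the set of plays from $s$ that are consistent with $\sigma_1$. Player 1 tries to minimize the payoff, player 2 to maximize it. Let $AE$ be either of $\overline{AE}$,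 $\underline{AE}$. The \emph{value} from $s$ is $v(s) = \inf\{t \in \mathbb{Q} \mid \exists \sigma_1\ \forall \pi \in \mathrm{Outs}(s,\sigma_1):\ AE(\pi) \le t\} \in [-\infty,+\infty]$. \textbf{Theorem.} In every such game, for either variant $AE$: (1) (determinacy) for every initial state $s$ and every threshold $t \in \mathbb{Q}$, either player 1 has a strategy $\sigma_1$ with $AE(\mathrm{Out}(s,\sigma_1,\sigma_2)) \le t$ for all $\sigma_2$, or player 2 has a strategy $\sigma_2$ with $AE(\mathrm{Out}(s,\sigma_1,\sigma_2)) > t$ for all $\sigma_1$; (2) player 1 has a memoryless optimal strategy: a memoryless $\sigma_1$ such that $AE(\mathrm{Out}(s,\sigma_1,\sigma_2)) \le v(s)$ for every initial state $s$ and every strategy $\sigma_2$; (3) player 2 has a memoryless optimal strategy: a memoryless $\sigma_2$ such that $AE(\mathrm{Out}(s,\sigma_1,\sigma_2)) \ge v(s)$ for every initial state $s$ and every strategy $\sigma_1$. -/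

import Mathlib

open Filter

/-- The two players. -/
inductive Player : Type
  | one
  | two

/-- A turn-based weighted game graph on the state set `S` (assumed finite in the theorem).
`owner` is the partition of `S` into the states of the two players, one of which may be empty.
The weight is a total function for convenience: only its values on edges are ever used. -/
structure Game (S : Type*) where
  owner : S → Player
  Edge : S → S → Prop
  no_deadlock : ∀ s, ∃ s', Edge s s'
  weight : S → S → ℤ

namespace Game

variable {S : Type*} (G : Game S)

/-- `h ++ [s]` is a prefix of the game: a nonempty finite path, with last state `s`. -/
def IsPrefix (h : List S) (s : S) : Prop :=
  (h ++ [s]).IsChain G.Edge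

/-- A play: an infinite path of the game graph. -/
structure Play where
  state : ℕ → S
  edge : ∀ n, G.Edge (state n) (state (n + 1))

/-- A strategy of player `i`: it maps each prefix `h ++ [s]` whose last state `s` belongs to
player `i` to a successor of `s`. (The values of `next` on all other arguments are never used.) -/
structure Strategy (i : Player) where
  next : List S → S → S
  legal : ∀ h s, G.IsPrefix h s → G.owner s = i → G.Edge s (next h s)

variable {G}

/-- The choice of a memoryless strategy depends only on the last state of the prefix. -/
def Strategy.Memoryless {i : Player} (σ : G.Strategy i) : Prop :=
  ∃ f : S → S, ∀ h s, G.IsPrefix h s → G.owner s = i → σ.next h s = f s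

namespace Play

/-- The states `s₀, …, sₙ₋₁` before position `n`, so that the prefix of the play up to
position `n` is `π.past n ++ [π.state n]`. -/
def past (π : G.Play) (n : ℕ) : List S :=
  (List.range n).map π.state

/-- `π` is consistent with the strategy `σ` of player `i`. -/
def Consistent {i : Player} (π : G.Play) (σ : G.Strategy i) : Prop :=
  ∀ n, G.owner (π.state n) = i → σ.next (π.past n) (π.state n) = π.state (n + 1)

/-- The energy level at position `n`: the sum of the first `n` weights. -/
def energy (π : G.Play) (n : ℕ) : ℤ :=
  ∑ i ∈ Finset.range n, G.weight (π.state i) (π.state (i + 1))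

/-- The average of the energy levels at the positions `1, …, n`. -/
noncomputable def avgEnergy (π : G.Play) (n : ℕ) : ℝ :=
  (1 / (n : ℝ)) * ∑ i ∈ Finset.Icc 1 n, (π.energy i : ℝ)

/-- The average-energy payoff, limsup variant, as an extended real. -/
noncomputable def avgEnergySup (π : G.Play) : EReal :=
  limsup (fun n : ℕ => (π.avgEnergy n : EReal)) atTop

/-- The average-energy payoff, liminf variant, as an extended real. -/
noncomputable def avgEnergyInf (π : G.Play) : EReal :=
  liminf (fun n : ℕ => (π.avgEnergy n : EReal)) atTop

end Play

/-- The next state after the prefix `h ++ [s]` when the players follow `σ₁` and `σ₂`. -/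
def step (σ₁ : G.Strategy .one) (σ₂ : G.Strategy .two) (h : List S) (s : S) : S :=
  match G.owner s with
  | .one => σ₁.next h s
  | .two => σ₂.next h s

/-- The prefix reached after `n` moves from `s₀`, as a pair (earlier states, last state). -/
def run (s₀ : S) (σ₁ : G.Strategy .one) (σ₂ : G.Strategy .two) : ℕ → List S × S
  | 0 => ([], s₀)
  | n + 1 =>
    let p := run s₀ σ₁ σ₂ n
    (p.1 ++ [p.2], step σ₁ σ₂ p.1 p.2)

theorem step_edge (σ₁ : G.Strategy .one) (σ₂ : G.Strategy .two) (h : List S) (s : S)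
    (hp : G.IsPrefix h s) : G.Edge s (step σ₁ σ₂ h s) := by
  unfold step
  split
  · next hs => exact σ₁.legal h s hp hs
  · next hs => exact σ₂.legal h s hp hs

theorem run_isPrefix (s₀ : S) (σ₁ : G.Strategy .one) (σ₂ : G.Strategy .two) (n : ℕ) :
    G.IsPrefix (run s₀ σ₁ σ₂ n).1 (run s₀ σ₁ σ₂ n).2 := by
  induction n with
  | zero => simp [run, IsPrefix]
  | succ n ih =>
    have hs := step_edge σ₁ σ₂ _ _ ih
    simp only [run]
    unfold IsPrefix at ih ⊢
    rw [List.isChain_append]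
    refine ⟨ih, by simp, ?_⟩
    simpa using hs

/-- The play from `s₀` in which the players follow `σ₁` and `σ₂`. -/
def outcome (s₀ : S) (σ₁ : G.Strategy .one) (σ₂ : G.Strategy .two) : G.Play where
  state n := (run s₀ σ₁ σ₂ n).2
  edge n := step_edge σ₁ σ₂ _ _ (run_isPrefix s₀ σ₁ σ₂ n)

/-- The plays from `s₀` that are consistent with the strategy `σ`. -/
def outcomes {i : Player} (s₀ : S) (σ : G.Strategy i) : Set G.Play :=
  {π | π.state 0 = s₀ ∧ π.Consistent σ}

theorem outcome_past (s₀ : S) (σ₁ : G.Strategy .one) (σ₂ : G.Strategy .two) (n : ℕ) :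
    (outcome s₀ σ₁ σ₂).past n = (run s₀ σ₁ σ₂ n).1 := by
  induction n with
  | zero => simp [Play.past, run]
  | succ n ih =>
    unfold Play.past at ih ⊢
    rw [List.range_succ, List.map_append, ih]
    simp [run, outcome]

/-- `outcome s₀ σ₁ σ₂` is the unique play from `s₀` consistent with both strategies. -/
theorem eq_outcome_iff (s₀ : S) (σ₁ : G.Strategy .one) (σ₂ : G.Strategy .two) (π : G.Play) :
    π = outcome s₀ σ₁ σ₂ ↔ π ∈ outcomes s₀ σ₁ ∧ π ∈ outcomes s₀ σ₂ := by
  constructor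
  · rintro rfl
    refine ⟨⟨rfl, fun n hn => ?_⟩, ⟨rfl, fun n hn => ?_⟩⟩ <;>
    · rw [outcome_past]
      simp only [outcome] at hn ⊢
      simp [run, step, hn]
  · rintro ⟨⟨h0, h1⟩, ⟨-, h2⟩⟩
    have key : ∀ n, (π.past n, π.state n) = run s₀ σ₁ σ₂ n := by
      intro n
      induction n with
      | zero => simp [Play.past, run, h0]
      | succ n ih =>
        simp only [run, ← ih]
        refine Prod.ext ?_ ?_
        · simp [Play.past, List.range_succ]
        · have a := h1 n
          have b := h2 n
          simp only [step]
          split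
          · next hs => exact (a hs).symm
          · next hs => exact (b hs).symm
    have hst : π.state = (outcome s₀ σ₁ σ₂).state := by
      funext n
      exact congrArg Prod.snd (key n)
    cases π
    simp only at hst
    subst hst
    rfl

/-- The objective of player 1 for the payoff `P` and the threshold `t`: payoff at most `t`. -/
def objective (P : G.Play → EReal) (t : ℚ) : Set G.Play :=
  {π | P π ≤ ((t : ℝ) : EReal)}

/-- `σ₁` is winning for player 1 from `s₀` for the objective `W`. -/
def WinningOne (s₀ : S) (W : Set G.Play) (σ₁ : G.Strategy .one) : Prop :=
  ∀ σ₂ : G.Strategy .two, outcome s₀ σ₁ σ₂ ∈ W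

/-- `σ₂` is winning for player 2 from `s₀` against the objective `W` of player 1. -/
def WinningTwo (s₀ : S) (W : Set G.Play) (σ₂ : G.Strategy .two) : Prop :=
  ∀ σ₁ : G.Strategy .one, outcome s₀ σ₁ σ₂ ∉ W

/-- The game with payoff `P` is determined: for every initial state and every threshold, one of
the two players has a winning strategy. -/
def Determined (P : G.Play → EReal) : Prop :=
  ∀ (s₀ : S) (t : ℚ),
    (∃ σ₁, WinningOne s₀ (objective P t) σ₁) ∨ (∃ σ₂, WinningTwo s₀ (objective P t) σ₂)

/-- The value from `s₀`: the infimum in the extended reals of the rational thresholds that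
player 1 can ensure. -/
noncomputable def value (P : G.Play → EReal) (s₀ : S) : EReal :=
  sInf {x : EReal | ∃ t : ℚ, x = ((t : ℝ) : EReal) ∧
    ∃ σ₁ : G.Strategy .one, outcomes s₀ σ₁ ⊆ objective P t}

/-- `σ₁` is optimal for player 1 (the minimizer): from every initial state it ensures a payoff
at most the value. -/
def OptimalOne (P : G.Play → EReal) (σ₁ : G.Strategy .one) : Prop :=
  ∀ (s₀ : S) (σ₂ : G.Strategy .two), P (outcome s₀ σ₁ σ₂) ≤ value P s₀

/-- `σ₂` is optimal for player 2 (the maximizer): from every initial state it ensures a payoff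
at least the value. -/
def OptimalTwo (P : G.Play → EReal) (σ₂ : G.Strategy .two) : Prop :=
  ∀ (s₀ : S) (σ₁ : G.Strategy .one), value P s₀ ≤ P (outcome s₀ σ₁ σ₂)

end Game

/-!
The average energy is the second-order refinement of the mean payoff, and therefore governed by
the expansion of discounted values at discount factor `1`.

For each `ε ∈ (0, 1)` the game with discount factor `1 - ε` has a value vector `V_ε`, the fixed
point of a contraction, and it is attained by one positional choice `f` for both players
(`Game.exists_discounted_solution`). There are finitely many positional choices, so one `f` is
optimal for arbitrarily small `ε`. For those `ε`, `V_ε = w_f + (1 - ε) V_ε ∘ f`, and linear algebra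
for the operator `x ↦ x - x ∘ f` yields an expansion `V_ε = g / ε + v + ε u + O(ε²)`
(`Game.exists_expansion`). Comparing coefficients in the discounted optimality inequalities
shows that every edge of player 2 makes the triple `(g, v, u)` lexicographically decrease, every edge
of player 1 makes it increase, and the edges of `f` satisfy the equations exactly
(`Game.exists_lexPotential`).

These conditions bound the average energy along any single play
(`Game.eventually_average_le_of_lexDecreasing`). Suppose all edges of the play are decreasing and
`g = 0` at its start. If `g` ever drops, then energies tend to `-∞`. Otherwise `v` is a potential: the
energy at position `n` is `v (s 0) - v (s n)` minus an accumulated loss, which either diverges or is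
eventually constant because the losses on edges take finitely many values. In the last case the
inequality for `u` bounds the sums of `v (s n)` from below, so the averages of the energies are
asymptotically at most `v (s 0)`. If `g < 0` at the start, the energies tend to `-∞`. Changing all signs
gives the bound from below. Hence following `f` is optimal for either player, and the value is
`-∞`, `v` or `+∞` according to the sign of `g`. The upper bound holds for the limsup and the lower bound
for the liminf, so that both payoff variants are covered at once.
-/

open Topology

namespace Game

variable {S : Type*}

/-! ### Averages of sequences -/

/-- If `E (n + 1)` is eventually at most `r` up to a bounded telescoping term, then the averages
of `E 1, …, E n` are eventually below every `r' > r`. -/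
theorem eventually_average_le {E u : ℕ → ℝ} {r r' B : ℝ} (hr : r < r') (hu : ∀ n, |u n| ≤ B)
    (h : ∀ᶠ n in atTop, E (n + 1) ≤ r + (u n - u (n + 1))) :
    ∀ᶠ n : ℕ in atTop, (1 / (n : ℝ)) * ∑ i ∈ Finset.Icc 1 n, E i ≤ r' := by
  obtain ⟨N, hN⟩ := eventually_atTop.1 h
  set A : ℕ → ℝ := fun n => ∑ i ∈ Finset.Icc 1 n, E i with hA
  have hstep : ∀ n, A (n + 1) = A n + E (n + 1) := fun n =>
    Finset.sum_Icc_succ_top (by omega) E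
  have hbd : ∀ n, N ≤ n → A n ≤ A N + r * (n - N) + (u N - u n) := by
    intro n hn
    induction n, hn using Nat.le_induction with
    | base => simp
    | succ n hn ih =>
      have := hN n hn
      rw [hstep]
      push_cast
      linarith
  set K : ℝ := A N - r * N + 2 * B with hK
  have hKn : ∀ n, N ≤ n → A n ≤ K + r * n := by
    intro n hn
    have h1 := hbd n hn
    have h2 := abs_le.1 (hu N)
    have h3 := abs_le.1 (hu n)
    rw [hK]
    linarith
  have hlim : Tendsto (fun n : ℕ => K / (n : ℝ)) atTop (𝓝 0) :=
    tendsto_const_div_atTop_nhds_zero_nat K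
  filter_upwards [hlim.eventually (gt_mem_nhds (sub_pos.2 hr)), eventually_ge_atTop N,
    eventually_gt_atTop 0] with n h1 h2 h3
  have hn : (0 : ℝ) < n := by exact_mod_cast h3
  rw [div_lt_iff₀ hn] at h1
  rw [one_div, inv_mul_le_iff₀ hn]
  have := hKn n h2
  change A n ≤ _
  linarith

/-- If a sequence tends to `-∞`, then so do its averages. -/
theorem eventually_average_le_of_tendsto {E : ℕ → ℝ} (h : Tendsto E atTop atBot) (r : ℝ) :
    ∀ᶠ n : ℕ in atTop, (1 / (n : ℝ)) * ∑ i ∈ Finset.Icc 1 n, E i ≤ r := by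
  refine eventually_average_le (u := fun _ => 0) (B := 0) (sub_one_lt r) (by simp) ?_
  have := (tendsto_add_atTop_iff_nat 1).2 h
  simpa using this.eventually (eventually_le_atBot (r - 1))

theorem eventually_eq_of_antitone_comp [Finite S] (g : S → ℝ) {s : ℕ → S}
    (h : ∀ n, g (s (n + 1)) ≤ g (s n)) : ∃ N, ∀ n, N ≤ n → g (s n) = g (s N) := by
  have hfin : (Set.range (g ∘ s)).Finite :=
    (Set.finite_range g).subset (Set.range_comp_subset_range s g)
  obtain ⟨_, ⟨⟨N, rfl⟩, hN⟩⟩ := hfin.exists_minimal (Set.range_nonempty _)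
  have hanti : Antitone (g ∘ s) := antitone_nat_of_succ_le h
  exact ⟨N, fun n hn => le_antisymm (hanti hn) (hN ⟨n, rfl⟩ (hanti hn))⟩

theorem exists_abs_le [Finite S] (x : S → ℝ) : ∃ B, ∀ s, |x s| ≤ B := by
  obtain ⟨B, hB⟩ := (Set.finite_range fun s => |x s|).bddAbove
  exact ⟨B, fun s => hB ⟨s, rfl⟩⟩

/-! ### Lexicographic potentials along a path -/

/-- The triple `(a, b, c)` is nonnegative in the lexicographic order. -/
def LexNonneg (a b c : ℝ) : Prop :=
  0 < a ∨ a = 0 ∧ (0 < b ∨ b = 0 ∧ 0 ≤ c)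

/-- The coefficients of `ε⁻¹`, `1` and `ε` in `V s - (w s s' + (1 - ε) * V s')` for
`V = g / ε + v + ε u`, as a condition on the edge from `s` to `s'`: lexicographically, they
are nonnegative. -/
def LexDecreasing (w : S → S → ℝ) (g v u : S → ℝ) (s s' : S) : Prop :=
  LexNonneg (g s - g s') (v s - v s' - w s s' + g s') (u s - u s' + v s')

/-- Along a path all of whose edges are lexicographically decreasing, the average energy is at most
`-∞` if the gain `g` is negative at the start, and at most `v` at the start if `g` vanishes
there. -/
theorem eventually_average_le_of_lexDecreasing [Finite S] {w : S → S → ℝ} {g v u : S → ℝ}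
    {s : ℕ → S} (h : ∀ n, LexDecreasing w g v u (s n) (s (n + 1)))
    (r : ℝ) (hr : g (s 0) < 0 ∨ g (s 0) = 0 ∧ v (s 0) < r) :
    ∀ᶠ n : ℕ in atTop, (1 / (n : ℝ)) *
      ∑ i ∈ Finset.Icc 1 n, ∑ j ∈ Finset.range i, w (s j) (s (j + 1)) ≤ r := by
  set E : ℕ → ℝ := fun n => ∑ j ∈ Finset.range n, w (s j) (s (j + 1)) with hE
  change ∀ᶠ n : ℕ in atTop, (1 / (n : ℝ)) * ∑ i ∈ Finset.Icc 1 n, E i ≤ r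
  have hEs : ∀ n, E (n + 1) = E n + w (s n) (s (n + 1)) := fun n => Finset.sum_range_succ _ n
  obtain ⟨B, hB⟩ := exists_abs_le v
  obtain ⟨U, hU⟩ := exists_abs_le u
  have hg : ∀ n, g (s (n + 1)) ≤ g (s n) := by
    intro n
    rcases h n with h | h <;> linarith [h]
  have hanti : Antitone fun n => g (s n) := antitone_nat_of_succ_le hg
  obtain ⟨N, hN⟩ := eventually_eq_of_antitone_comp g hg
  have hN0 : g (s N) ≤ g (s 0) := hanti (Nat.zero_le N)
  rcases lt_or_ge (g (s N)) 0 with hneg | hpos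
  · -- The gain ends up at a negative constant, so the energy decreases linearly.
    apply eventually_average_le_of_tendsto
    have hbd : ∀ n, N ≤ n → E n ≤ E N + v (s N) - v (s n) + g (s N) * (n - N) := by
      intro n hn
      induction n, hn using Nat.le_induction with
      | base => simp
      | succ n hn ih =>
        have h1 := hN n hn
        have h2 := hN (n + 1) (by omega)
        rw [hEs]
        push_cast
        rcases h n with h | ⟨-, h | ⟨h, -⟩⟩ <;> linarith
    have hlim : Tendsto (fun n : ℕ => (E N + v (s N) + B - g (s N) * N) + g (s N) * (n : ℝ))
        atTop atBot :=
      tendsto_atBot_add_const_left _ _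
        (tendsto_natCast_atTop_atTop.const_mul_atTop_of_neg hneg)
    refine tendsto_atBot_mono' _ ?_ hlim
    filter_upwards [eventually_ge_atTop N] with n hn
    have h1 := hbd n hn
    have h2 := abs_le.1 (hB (s n))
    linarith
  · have hg0 : g (s 0) = 0 := by
      rcases hr with hr | hr <;> linarith [hr]
    have hvr : v (s 0) < r := by
      rcases hr with hr | hr
      · linarith
      · exact hr.2
    have hgz : ∀ n, g (s n) = 0 := by
      intro n
      refine le_antisymm (hg0 ▸ hanti (Nat.zero_le n)) ?_
      rcases le_total N n with hn | hn
      · rw [hN n hn]; exact hpos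
      · exact hpos.trans (hanti hn)
    -- The loss of potential on an edge; nonnegative along the path.
    set φ : S × S → ℝ := fun p => v p.1 - v p.2 - w p.1 p.2 with hφ
    set d : ℕ → ℝ := fun n => φ (s n, s (n + 1)) with hd
    have hd0 : ∀ n, 0 ≤ d n := by
      intro n
      have := hgz (n + 1)
      simp only [hd, hφ]
      rcases h n with h | ⟨-, h | ⟨h, -⟩⟩ <;> linarith [hgz n]
    have hED : ∀ n, E n = v (s 0) - v (s n) - ∑ i ∈ Finset.range n, d i := by
      intro n
      induction n with
      | zero => simp [hE]
      | succ n ih =>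
        rw [hEs, ih, Finset.sum_range_succ]
        simp only [hd, hφ]
        ring
    have hmono : Monotone fun n => ∑ i ∈ Finset.range n, d i :=
      monotone_nat_of_le_succ fun n => by
        rw [Finset.sum_range_succ]; linarith [hd0 n]
    rcases tendsto_atTop_of_monotone hmono with htop | ⟨l, hl⟩
    · apply eventually_average_le_of_tendsto
      have hlim : Tendsto (fun n => (v (s 0) + B) + -∑ i ∈ Finset.range n, d i) atTop atBot :=
        tendsto_atBot_add_const_left _ _ (tendsto_neg_atTop_atBot.comp htop)
      refine tendsto_atBot_mono (fun n => ?_) hlim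
      have h2 := abs_le.1 (hB (s n))
      rw [hED]
      linarith
    · -- The losses tend to `0` and take finitely many values, so they eventually vanish.
      have hdlim : Tendsto d atTop (𝓝 0) := by
        have := ((tendsto_add_atTop_iff_nat 1).2 hl).sub hl
        simpa [Finset.sum_range_succ] using this
      have hopen : (Set.range φ \ {0})ᶜ ∈ 𝓝 (0 : ℝ) :=
        ((Set.finite_range φ).sdiff.isClosed.isOpen_compl).mem_nhds (by simp)
      refine eventually_average_le (u := fun n => u (s n)) hvr (fun n => hU _) ?_
      filter_upwards [hdlim.eventually hopen] with n hn
      have hdn : d n = 0 := by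
        by_contra hne
        exact hn ⟨⟨_, rfl⟩, hne⟩
      have hc : 0 ≤ u (s n) - u (s (n + 1)) + v (s (n + 1)) := by
        have h1 := hgz (n + 1)
        simp only [hd, hφ] at hdn
        rcases h n with h | ⟨-, h | ⟨-, h⟩⟩ <;> linarith [hgz n]
      have hs : 0 ≤ ∑ i ∈ Finset.range (n + 1), d i := Finset.sum_nonneg fun i _ => hd0 i
      rw [hED]
      linarith

/-! ### The discounted game -/

/-- The Bellman operator of the discounted game. -/
noncomputable def bellman (G : Game S) (l : ℝ) (V : S → ℝ) (s : S) : ℝ :=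
  match G.owner s with
  | .one => ⨅ e : {s' // G.Edge s s'}, ((G.weight s e : ℝ) + l * V e)
  | .two => ⨆ e : {s' // G.Edge s s'}, ((G.weight s e : ℝ) + l * V e)

theorem bellman_le [Finite S] (G : Game S) {l : ℝ} (hl : 0 ≤ l) {V W : S → ℝ} {d : ℝ}
    (h : ∀ s, V s ≤ W s + d) (s : S) : G.bellman l V s ≤ G.bellman l W s + l * d := by
  have : Nonempty {s' // G.Edge s s'} := let ⟨s', h⟩ := G.no_deadlock s; ⟨⟨s', h⟩⟩
  have key : ∀ e : {s' // G.Edge s s'},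
      (G.weight s e : ℝ) + l * V e ≤ (G.weight s e : ℝ) + l * W e + l * d := fun e => by
    nlinarith [mul_le_mul_of_nonneg_left (h e) hl]
  unfold bellman
  split
  · rw [← sub_le_iff_le_add]
    refine le_ciInf fun e => ?_
    rw [sub_le_iff_le_add]
    exact (ciInf_le (Set.finite_range _).bddBelow e).trans (key e)
  · refine ciSup_le fun e => (key e).trans (add_le_add_left ?_ _)
    exact le_ciSup (f := fun e : {s' // G.Edge s s'} => (G.weight s e : ℝ) + l * W e)
      (Set.finite_range _).bddAbove e

/-- The discounted game with discount factor `1 - ε` is solved by positional choices `f`. -/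
theorem exists_discounted_solution [Finite S] (G : Game S) {ε : ℝ} (h0 : 0 < ε) (h1 : ε < 1) :
    ∃ (V : S → ℝ) (f : S → S), (∀ s, G.Edge s (f s)) ∧
      (∀ s, V s = G.weight s (f s) + (1 - ε) * V (f s)) ∧
      ∀ s s', G.Edge s s' →
        (G.owner s = .two → G.weight s s' + (1 - ε) * V s' ≤ V s) ∧
        (G.owner s = .one → V s ≤ G.weight s s' + (1 - ε) * V s') := by
  have := Fintype.ofFinite S
  have hl : 0 ≤ 1 - ε := by linarith
  have hc : ContractingWith (1 - ε).toNNReal (G.bellman (1 - ε)) := by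
    refine ⟨by simpa using h0, LipschitzWith.of_dist_le_mul ?_⟩
    intro V W
    have hVW : ∀ s, |V s - W s| ≤ dist V W := fun s => by
      rw [← Real.dist_eq]; exact dist_le_pi_dist V W s
    refine (dist_pi_le_iff (by positivity)).2 fun s => ?_
    rw [Real.dist_eq, abs_le]
    have ha := G.bellman_le hl (V := V) (W := W) (d := dist V W)
      (fun s => by linarith [abs_le.1 (hVW s)]) s
    have hb := G.bellman_le hl (V := W) (W := V) (d := dist V W)
      (fun s => by linarith [abs_le.1 (hVW s)]) s
    rw [Real.coe_toNNReal _ hl]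
    constructor <;> linarith
  obtain ⟨V, hV⟩ : ∃ V, G.bellman (1 - ε) V = V := ⟨_, hc.fixedPoint_isFixedPt⟩
  have hf : ∀ s, ∃ s', G.Edge s s' ∧ V s = G.weight s s' + (1 - ε) * V s' := by
    intro s
    have : Nonempty {s' // G.Edge s s'} := let ⟨s', h⟩ := G.no_deadlock s; ⟨⟨s', h⟩⟩
    have hs := congrFun hV s
    unfold bellman at hs
    split at hs
    · obtain ⟨e, he⟩ := exists_eq_ciInf_of_finite
        (f := fun e : {s' // G.Edge s s'} => (G.weight s e : ℝ) + (1 - ε) * V e)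
      exact ⟨e, e.2, (he.trans hs).symm⟩
    · obtain ⟨e, he⟩ := exists_eq_ciSup_of_finite
        (f := fun e : {s' // G.Edge s s'} => (G.weight s e : ℝ) + (1 - ε) * V e)
      exact ⟨e, e.2, (he.trans hs).symm⟩
  choose f hf1 hf2 using hf
  refine ⟨V, f, hf1, hf2, fun s s' he => ⟨fun ho => ?_, fun ho => ?_⟩⟩
  · have hs := congrFun hV s
    simp only [bellman, ho] at hs
    rw [← hs]
    exact le_ciSup (f := fun e : {s' // G.Edge s s'} => (G.weight s e : ℝ) + (1 - ε) * V e)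
      (Set.finite_range _).bddAbove ⟨s', he⟩
  · have hs := congrFun hV s
    simp only [bellman, ho] at hs
    rw [← hs]
    exact ciInf_le (f := fun e : {s' // G.Edge s s'} => (G.weight s e : ℝ) + (1 - ε) * V e)
      (Set.finite_range _).bddBelow ⟨s', he⟩

/-! ### Expansion of the discounted payoff of a positional strategy pair -/

/-- The difference operator `x ↦ x - x ∘ f`. -/
def diffOp (f : S → S) : (S → ℝ) →ₗ[ℝ] (S → ℝ) :=
  LinearMap.id - LinearMap.funLeft ℝ ℝ f

theorem diffOp_apply (f : S → S) (x : S → ℝ) (s : S) : diffOp f x s = x s - x (f s) := rfl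

/-- The constants along `f` that are of the form `y - y ∘ f` vanish: otherwise `y` would be
unbounded along the orbits of `f`. -/
theorem disjoint_ker_range_diffOp [Finite S] (f : S → S) :
    Disjoint (LinearMap.ker (diffOp f)) (LinearMap.range (diffOp f)) := by
  rw [Submodule.disjoint_def]
  rintro k hk ⟨y, rfl⟩
  set k := diffOp f y with hkd
  have hkf : ∀ s, k (f s) = k s := fun s => by
    have := congrFun (LinearMap.mem_ker.1 hk) s
    rw [diffOp_apply] at this
    simpa using (sub_eq_zero.1 this).symm
  obtain ⟨B, hB⟩ := exists_abs_le y
  have hit : ∀ n : ℕ, ∀ s, y s - y (f^[n] s) = n * k s := by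
    intro n
    induction n with
    | zero => simp
    | succ n ih =>
      intro s
      have h1 := ih (f s)
      have h2 : k s = y s - y (f s) := rfl
      rw [hkf] at h1
      rw [Function.iterate_succ_apply]
      push_cast
      linarith
  ext s
  by_contra hne
  have hpos : 0 < |k s| := abs_pos.2 hne
  obtain ⟨n, hn⟩ := exists_nat_gt (2 * B / |k s|)
  rw [div_lt_iff₀ hpos] at hn
  have h1 : |(n : ℝ) * k s| ≤ 2 * B := by
    rw [← hit n s]
    have h1 := abs_le.1 (hB s)
    have h2 := abs_le.1 (hB (f^[n] s))
    rw [abs_le]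
    constructor <;> linarith
  rw [abs_mul, Nat.abs_cast] at h1
  linarith

theorem exists_eq_add_diffOp [Finite S] (f : S → S) (w : S → ℝ) :
    ∃ g x, diffOp f g = 0 ∧ w = g + diffOp f x := by
  have htop := Submodule.eq_top_of_disjoint _ _
    (by rw [add_comm]; exact (diffOp f).finrank_range_add_finrank_ker.ge)
    (disjoint_ker_range_diffOp f)
  have hw : w ∈ LinearMap.ker (diffOp f) ⊔ LinearMap.range (diffOp f) := by
    rw [htop]; trivial
  obtain ⟨g, hg, _, ⟨x, rfl⟩, h⟩ := Submodule.mem_sup.1 hw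
  exact ⟨g, x, hg, h.symm⟩

theorem exists_eq_add_diffOp_iterate [Finite S] (f : S → S) (w : S → ℝ) :
    ∃ g z, diffOp f g = 0 ∧ w = g + diffOp f (diffOp f (diffOp f z)) := by
  obtain ⟨g, x, hg, rfl⟩ := exists_eq_add_diffOp f w
  obtain ⟨k, y, hk, rfl⟩ := exists_eq_add_diffOp f x
  obtain ⟨m, z, hm, rfl⟩ := exists_eq_add_diffOp f y
  exact ⟨g, z, hg, by simp [hk, hm]⟩

/-- The discounted payoff of a positional choice `f` has an expansion
`V = g / ε + v + ε u + O(ε²)` for small `ε`, with coefficients independent of `ε`. -/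
theorem exists_expansion [Finite S] (f : S → S) (w : S → ℝ) :
    ∃ (g v u : S → ℝ) (C : ℝ), ∀ (ε : ℝ) (V : S → ℝ), 0 < ε → ε < 1 →
      (∀ s, V s = w s + (1 - ε) * V (f s)) →
      ∀ s, |V s - (g s / ε + v s + ε * u s)| ≤ C * ε ^ 2 := by
  obtain ⟨g, z, hg, hw⟩ := exists_eq_add_diffOp_iterate f w
  -- With `A = diffOp f`, `P x = x ∘ f` and `w = g + A³ z`, the coefficients are
  -- `v = A² z`, `u = -P A z` and `t = P² z`; the term `ε² t` makes the residual `O(ε³)`.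
  set t : S → ℝ := fun s => z (f (f s)) with ht
  obtain ⟨B, hB⟩ := exists_abs_le t
  refine ⟨g, diffOp f (diffOp f z), fun s => -diffOp f z (f s), B + B, ?_⟩
  intro ε V h0 h1 hV s
  set D : S → ℝ := fun s =>
    V s - (g s / ε + diffOp f (diffOp f z) s + ε * -diffOp f z (f s) + ε ^ 2 * t s) with hD
  have hrec : ∀ s, D s = (1 - ε) * D (f s) - ε ^ 3 * t (f s) := by
    intro s
    have hgs : g (f s) = g s := by
      have := congrFun hg s
      rw [diffOp_apply] at this
      simpa using (sub_eq_zero.1 this).symm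
    have hws := congrFun hw s
    simp only [Pi.add_apply, diffOp_apply] at hws
    have hVs := hV s
    rw [hws] at hVs
    simp only [hD, ht, diffOp_apply, hgs, hVs]
    field_simp
    ring
  have : Nonempty S := ⟨s⟩
  obtain ⟨m, hm⟩ := Finite.exists_max fun s => |D s|
  have hDm : |D m| ≤ B * ε ^ 2 := by
    have ha : |D m| ≤ (1 - ε) * |D m| + ε ^ 3 * B := by
      calc |D m| = |(1 - ε) * D (f m) - ε ^ 3 * t (f m)| := by rw [← hrec]
        _ ≤ |(1 - ε) * D (f m)| + |ε ^ 3 * t (f m)| := abs_sub _ _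
        _ = (1 - ε) * |D (f m)| + ε ^ 3 * |t (f m)| := by
          rw [abs_mul, abs_mul, abs_of_pos (sub_pos.2 h1), abs_of_pos (pow_pos h0 3)]
        _ ≤ _ := by
          exact add_le_add (mul_le_mul_of_nonneg_left (hm _) (sub_pos.2 h1).le)
            (mul_le_mul_of_nonneg_left (hB _) (pow_pos h0 3).le)
    have hb : ε * |D m| ≤ ε * (B * ε ^ 2) := by nlinarith
    exact le_of_mul_le_mul_left hb h0
  have hsplit : V s - (g s / ε + diffOp f (diffOp f z) s + ε * -diffOp f z (f s))
      = D s + ε ^ 2 * t s := by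
    simp only [hD]; ring
  rw [hsplit]
  refine (abs_add_le _ _).trans ?_
  rw [abs_mul, abs_of_pos (pow_pos h0 2), add_mul]
  have h2 := mul_le_mul_of_nonneg_left (hB s) (pow_pos h0 2).le
  have h3 := (hm s).trans hDm
  linarith

/-! ### Lexicographic solution of the optimality equations -/

/-- If `a / ε + b + ε c + O(ε²)` is nonnegative for arbitrarily small `ε > 0`, then `(a, b, c)` is
lexicographically nonnegative. -/
theorem lexNonneg_of_frequently {a b c C : ℝ}
    (h : ∃ᶠ ε : ℝ in 𝓝[>] 0, 0 ≤ a / ε + b + ε * c + C * ε ^ 2) : LexNonneg a b c := by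
  have hpos : ∀ᶠ ε : ℝ in 𝓝[>] 0, 0 < ε := self_mem_nhdsWithin
  have hlim : ∀ p : ℝ → ℝ, Continuous p → Tendsto p (𝓝[>] 0) (𝓝 (p 0)) := fun p hp =>
    (hp.tendsto 0).mono_left nhdsWithin_le_nhds
  have hfreq := h.and_eventually hpos
  have ha : 0 ≤ a := by
    have hl := hlim (fun ε => a + ε * b + ε ^ 2 * c + C * ε ^ 3) (by fun_prop)
    have : 0 ≤ a + 0 * b + 0 ^ 2 * c + C * 0 ^ 3 := ge_of_tendsto_of_frequently hl <|
      hfreq.mono fun ε ⟨h1, h2⟩ => by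
        have := mul_nonneg h1 h2.le
        field_simp at this
        nlinarith
    simpa using this
  rcases ha.lt_or_eq with ha | rfl
  · exact Or.inl ha
  refine Or.inr ⟨rfl, ?_⟩
  have hb : 0 ≤ b := by
    have hl := hlim (fun ε => b + ε * c + C * ε ^ 2) (by fun_prop)
    have : 0 ≤ b + 0 * c + C * 0 ^ 2 := ge_of_tendsto_of_frequently hl <|
      hfreq.mono fun ε ⟨h1, h2⟩ => by simpa using h1
    simpa using this
  rcases hb.lt_or_eq with hb | rfl
  · exact Or.inl hb
  refine Or.inr ⟨rfl, ?_⟩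
  have hl := hlim (fun ε => c + C * ε) (by fun_prop)
  have : 0 ≤ c + C * 0 := ge_of_tendsto_of_frequently hl <|
    hfreq.mono fun ε ⟨h1, h2⟩ => by
      have h3 : 0 ≤ ε * (c + C * ε) := by
        rw [zero_div] at h1
        linarith
      exact nonneg_of_mul_nonneg_right h3 h2
  simpa using this

/-- If for arbitrarily small `ε` a function `V` with the given expansion does not increase along
the edge from `s` to `s'`, then that edge is lexicographically decreasing. -/
theorem lexDecreasing_of_frequently {w : S → S → ℝ} {g v u : S → ℝ} {V : ℝ → S → ℝ} {C : ℝ}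
    {s s' : S}
    (h : ∃ᶠ ε : ℝ in 𝓝[>] 0, (∀ s, |V ε s - (g s / ε + v s + ε * u s)| ≤ C * ε ^ 2) ∧
      w s s' + (1 - ε) * V ε s' ≤ V ε s) :
    LexDecreasing w g v u s s' := by
  refine lexNonneg_of_frequently (C := 2 * C + |u s'|) ?_
  have h01 : ∀ᶠ ε : ℝ in 𝓝[>] 0, ε ∈ Set.Ioo (0 : ℝ) 1 := Ioo_mem_nhdsGT one_pos
  refine (h.and_eventually h01).mono fun ε ⟨⟨h1, h2⟩, h3, h4⟩ => ?_
  have hs := (abs_le.1 (h1 s)).2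
  have hs' := (abs_le.1 (h1 s')).1
  have hC : 0 ≤ C * ε ^ 2 := (abs_nonneg _).trans (h1 s)
  have hm := mul_le_mul_of_nonneg_left hs' (sub_pos.2 h4).le
  have hu := mul_le_mul_of_nonneg_left (le_abs_self (u s')) (sq_nonneg ε)
  have hid : (1 - ε) * (V ε s' - (g s' / ε + v s' + ε * u s'))
      = (1 - ε) * V ε s' - (g s' / ε + v s' - g s' + ε * (u s' - v s') - ε ^ 2 * u s') := by
    field_simp
    ring
  have hid' : (g s - g s') / ε = g s / ε - g s' / ε := sub_div _ _ _
  rw [hid] at hm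
  rw [hid']
  nlinarith

/-- The optimality equations have a lexicographic solution, attained by one positional choice `f`
for both players: edges of player 2 do not increase `(g, v, u)`, edges of player 1 do not decrease
it, and the edges chosen by `f` do neither. -/
theorem exists_lexPotential [Finite S] (G : Game S) :
    ∃ (f : S → S) (g v u : S → ℝ), (∀ s, G.Edge s (f s)) ∧
      ∀ s s', G.Edge s s' →
        (G.owner s = .two ∨ f s = s' →
          LexDecreasing (fun a b => (G.weight a b : ℝ)) g v u s s') ∧
        (G.owner s = .one ∨ f s = s' →
          LexDecreasing (fun a b => -(G.weight a b : ℝ)) (-g) (-v) (-u) s s') := by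
  have hex : ∀ ε : ℝ, ∃ (V : S → ℝ) (f : S → S), 0 < ε → ε < 1 → (∀ s, G.Edge s (f s)) ∧
      (∀ s, V s = G.weight s (f s) + (1 - ε) * V (f s)) ∧
      ∀ s s', G.Edge s s' →
        (G.owner s = .two → G.weight s s' + (1 - ε) * V s' ≤ V s) ∧
        (G.owner s = .one → V s ≤ G.weight s s' + (1 - ε) * V s') := by
    intro ε
    by_cases h : 0 < ε ∧ ε < 1
    · obtain ⟨V, f, h⟩ := G.exists_discounted_solution h.1 h.2
      exact ⟨V, f, fun _ _ => h⟩
    · exact ⟨0, id, fun h0 h1 => absurd ⟨h0, h1⟩ h⟩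
  choose V F hVF using hex
  have h01 : ∀ᶠ ε : ℝ in 𝓝[>] 0, ε ∈ Set.Ioo (0 : ℝ) 1 := Ioo_mem_nhdsGT one_pos
  -- There are finitely many positional choices, so one is optimal for arbitrarily small `ε`.
  obtain ⟨f, hf⟩ : ∃ f, ∃ᶠ ε : ℝ in 𝓝[>] 0, F ε = f := by
    by_contra! hcon
    obtain ⟨ε, hε⟩ := (eventually_all.2 hcon).exists
    exact hε _ rfl
  have hfreq := hf.and_eventually h01
  obtain ⟨g, v, u, C, hexp⟩ := exists_expansion f (fun s => (G.weight s (f s) : ℝ))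
  obtain ⟨ε₀, rfl, hε₀, hε₁⟩ := hfreq.exists
  refine ⟨F ε₀, g, v, u, (hVF ε₀ hε₀ hε₁).1, fun s s' he => ⟨fun ho => ?_, fun ho => ?_⟩⟩
  · refine lexDecreasing_of_frequently (V := V) (C := C) (hfreq.mono ?_)
    rintro ε ⟨hFε, h0, h1⟩
    obtain ⟨-, h3, h4⟩ := hVF ε h0 h1
    rw [hFε] at h3
    refine ⟨hexp ε (V ε) h0 h1 h3, ?_⟩
    rcases ho with ho | rfl
    · exact (h4 s s' he).1 ho
    · exact (h3 s).ge
  · refine lexDecreasing_of_frequently (V := fun ε => -V ε) (C := C) (hfreq.mono ?_)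
    rintro ε ⟨hFε, h0, h1⟩
    obtain ⟨-, h3, h4⟩ := hVF ε h0 h1
    rw [hFε] at h3
    refine ⟨fun s => ?_, ?_⟩
    · have := hexp ε (V ε) h0 h1 h3 s
      rw [← abs_neg] at this
      convert this using 2
      simp only [Pi.neg_apply]
      ring
    · have : V ε s ≤ G.weight s s' + (1 - ε) * V ε s' := by
        rcases ho with ho | rfl
        · exact (h4 s s' he).2 ho
        · exact (h3 s).le
      simp only [Pi.neg_apply]
      linarith

/-! ### Values and optimal strategies -/

/-- The strategy of player `i` that follows the positional choice `f`. -/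
def positional {G : Game S} {f : S → S} (hf : ∀ s, G.Edge s (f s)) (i : Player) :
    G.Strategy i where
  next _ s := f s
  legal _ s _ _ := hf s

theorem positional_memoryless {G : Game S} {f : S → S} (hf : ∀ s, G.Edge s (f s)) (i : Player) :
    (positional hf i).Memoryless :=
  ⟨f, fun _ _ _ _ => rfl⟩

/-- The average-energy value read off from the gain `g` and the bias `v`. -/
noncomputable def gainValue (g v : S → ℝ) (s : S) : EReal :=
  if g s < 0 then ⊥ else if g s = 0 then (v s : EReal) else ⊤

theorem Play.avgEnergySup_le {G : Game S} [Finite S] {g v u : S → ℝ} (π : G.Play)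
    (h : ∀ n, LexDecreasing (fun a b => (G.weight a b : ℝ)) g v u (π.state n) (π.state (n + 1))) :
    π.avgEnergySup ≤ gainValue g v (π.state 0) := by
  refine EReal.le_of_forall_lt_iff_le.1 fun r hr => ?_
  have hr' : g (π.state 0) < 0 ∨ g (π.state 0) = 0 ∧ v (π.state 0) < r := by
    unfold gainValue at hr
    split_ifs at hr with h1 h2
    · exact Or.inl h1
    · exact Or.inr ⟨h2, by exact_mod_cast hr⟩
    · simp at hr
  refine limsup_le_of_le (by isBoundedDefault) ?_
  filter_upwards [eventually_average_le_of_lexDecreasing h r hr'] with n hn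
  rw [EReal.coe_le_coe_iff]
  simpa only [Play.avgEnergy, Play.energy, Int.cast_sum] using hn

theorem Play.le_avgEnergyInf {G : Game S} [Finite S] {g v u : S → ℝ} (π : G.Play)
    (h : ∀ n, LexDecreasing (fun a b => -(G.weight a b : ℝ)) (-g) (-v) (-u)
      (π.state n) (π.state (n + 1))) :
    gainValue g v (π.state 0) ≤ π.avgEnergyInf := by
  refine EReal.ge_of_forall_gt_iff_ge.1 fun r hr => ?_
  have hr' : (-g) (π.state 0) < 0 ∨ (-g) (π.state 0) = 0 ∧ (-v) (π.state 0) < -r := by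
    unfold gainValue at hr
    split_ifs at hr with h1 h2
    · simp at hr
    · exact Or.inr ⟨by simpa using h2, by simpa using hr⟩
    · exact Or.inl (by simpa using lt_of_le_of_ne (not_lt.1 h1) (Ne.symm h2))
  refine le_liminf_of_le (by isBoundedDefault) ?_
  filter_upwards [eventually_average_le_of_lexDecreasing h (-r) hr'] with n hn
  simp only [Finset.sum_neg_distrib, mul_neg, neg_le_neg_iff] at hn
  rw [EReal.coe_le_coe_iff]
  simpa only [Play.avgEnergy, Play.energy, Int.cast_sum] using hn

theorem Play.avgEnergyInf_le_avgEnergySup {G : Game S} (π : G.Play) :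
    π.avgEnergyInf ≤ π.avgEnergySup :=
  liminf_le_limsup

end Game

theorem mainTheorem1 {S : Type*} [Finite S] (G : Game S)
    (P : G.Play → EReal) (hP : P = Game.Play.avgEnergySup ∨ P = Game.Play.avgEnergyInf) :
    Game.Determined P ∧
      (∃ σ₁ : G.Strategy Player.one, σ₁.Memoryless ∧ Game.OptimalOne P σ₁) ∧
      (∃ σ₂ : G.Strategy Player.two, σ₂.Memoryless ∧ Game.OptimalTwo P σ₂) := by
  obtain ⟨f, g, v, u, hf, hlex⟩ := G.exists_lexPotential
  set val := Game.gainValue g v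
  have hle : ∀ π : G.Play, P π ≤ π.avgEnergySup := by
    rcases hP with rfl | rfl
    · exact fun π => le_rfl
    · exact fun π => π.avgEnergyInf_le_avgEnergySup
  have hge : ∀ π : G.Play, π.avgEnergyInf ≤ P π := by
    rcases hP with rfl | rfl
    · exact fun π => π.avgEnergyInf_le_avgEnergySup
    · exact fun π => le_rfl
  have hone : ∀ s, ∀ π ∈ Game.outcomes s (Game.positional hf .one), P π ≤ val s := by
    rintro s π ⟨rfl, hπ⟩
    refine (hle π).trans (π.avgEnergySup_le fun n => (hlex _ _ (π.edge n)).1 ?_)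
    cases ho : G.owner (π.state n)
    · exact Or.inr (hπ n ho)
    · exact Or.inl rfl
  have htwo : ∀ s, ∀ π ∈ Game.outcomes s (Game.positional hf .two), val s ≤ P π := by
    rintro s π ⟨rfl, hπ⟩
    refine (π.le_avgEnergyInf fun n => (hlex _ _ (π.edge n)).2 ?_).trans (hge π)
    cases ho : G.owner (π.state n)
    · exact Or.inl rfl
    · exact Or.inr (hπ n ho)
  have hmem : ∀ s σ₁ σ₂, Game.outcome s σ₁ σ₂ ∈ Game.outcomes s σ₁ ∧
      Game.outcome s σ₁ σ₂ ∈ Game.outcomes (G := G) s σ₂ := fun s σ₁ σ₂ =>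
    (Game.eq_outcome_iff s σ₁ σ₂ _).1 rfl
  have hvalue : ∀ s, Game.value P s = val s := by
    intro s
    apply le_antisymm
    · refine le_of_forall_gt fun x hx => ?_
      obtain ⟨t, ht, htx⟩ := EReal.lt_iff_exists_rat_btwn.1 hx
      refine lt_of_le_of_lt (sInf_le ⟨t, rfl, Game.positional hf .one, fun π hπ => ?_⟩) htx
      exact (hone s π hπ).trans ht.le
    · refine le_sInf ?_
      rintro _ ⟨t, rfl, σ₁, hσ₁⟩
      obtain ⟨h1, h2⟩ := hmem s σ₁ (Game.positional hf .two)
      exact (htwo s _ h2).trans (hσ₁ h1)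
  refine ⟨fun s t => ?_, ⟨_, Game.positional_memoryless hf .one, fun s σ₂ => ?_⟩,
    ⟨_, Game.positional_memoryless hf .two, fun s σ₁ => ?_⟩⟩
  · rcases le_or_gt (val s) ((t : ℝ) : EReal) with ht | ht
    · exact Or.inl ⟨_, fun σ₂ => (hone s _ (hmem s (Game.positional hf .one) σ₂).1).trans ht⟩
    · exact Or.inr ⟨_, fun σ₁ hcon =>
        (ht.trans_le (htwo s _ (hmem s σ₁ (Game.positional hf .two)).2)).not_ge hcon⟩
  · rw [hvalue]
    exact hone s _ (hmem s _ σ₂).1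
  · rw [hvalue]
    exact htwo s _ (hmem s σ₁ _).2
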